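/- Let $(q_k)_{k\ge 1}$ be a sequence of positive integers with $q_{k+1}\ge q_k(q_k+1)$ for all $k$ (a second Ostrogradsky sequence). Let $\xi_1,\xi_2,\dots$ be independent random variables taking the values $0$ and $1$ with probabilities $p_{0k}$ and $p_{1k}$ respectively ($p_{0k}+p_{1k}=1$), and let $\mu_\xi$ be the distribution of $$\xi=\sum_{k=1}^\infty \frac{(-1)^{k+1}\xi_k}{q_k}.$$ Assume that $\max\{p_{0k},p_{1k}\}<1$ for infinitely many $k$. For $i\in\{0,1\}$ put $p^*_{ik}=p_{ik}$ if $p_{ik}\in\{0,1\}$ and $p^*_{ik}=\tfrac12$ otherwise, and let $\nu^*$ (the uniform distribution on the spectrum of $\mu_\xi$) be the distribution of $\xi^*=\sum_{k=1}^\infty (-1)^{k+1}\xi^*_k/q_k$, where $\xi^*_1,\xi^*_2,\dots$ are independent and take the values $0$ and $1$ with probabilities $p^*_{0k}$ and $p^*_{1k}$. For a set $E\subset\mathbb R$, a probability measure $\nu$ on $\mathbb R$ without atoms and $\alpha>0$, let $$H^\alpha(E,\nu)=\lim_{\varepsilon\to0}\ \inf\Big\{\sum_j \nu(E_j)^\alpha\Big\},$$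 where the infimum is over all at most countable coverings of $E$ by bounded closed intervals $E_j$ with $\nu(E_j)\le\varepsilon$. Let $\dim_H(E,\nu)=\inf\{\alpha>0: H^\alpha(E,\nu)=0\}$, and define the Hausdorff--Billingsley dimension of a probability measure $\mu$ with respect to $\nu$ by $$\dim_H(\mu,\nu)=\inf\{\dim_H(E,\nu): E \text{ Borel},\ \mu(E)=1\}.$$ Let $h_n=-(p_{0n}\ln p_{0n}+p_{1n}\ln p_{1n})$ (with $0\ln 0=0$) be the entropy of $\xi_n$, let $H_n=h_1+\dots+h_n$, and let $g_n$ be the number of positive elements among $h_1,\dots,h_n$. Then $$\dim_H(\mu_\xi,\nu^*)=\liminf_{n\to\infty}\frac{H_n}{g_n\ln 2}.$$ -/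

import Mathlib

open MeasureTheory ProbabilityTheory Filter
open scoped ENNReal NNReal

noncomputable section

namespace Ostrogradsky

/-! ### Hausdorff-Billingsley measures and dimensions -/

/-- The `ν`-`α`-Hausdorff-Billingsley measure of `E` with respect to the family `Φ` of covering
sets: the limit as `ε → 0` (that is, the supremum over `ε > 0`, the expression being monotone in
`ε`) of the infimum of `∑ j, ν (E j) ^ α` over all at most countable coverings of `E` by members
of `Φ` whose `ν`-measures are at most `ε`. -/
def hbMeasure (α : ℝ≥0) (E : Set ℝ) (ν : Measure ℝ) (Φ : Set (Set ℝ)) : ℝ≥0∞ :=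
  ⨆ (ε : ℝ≥0∞) (_ : 0 < ε),
    ⨅ (𝒞 : Set (Set ℝ)) (_ : 𝒞 ⊆ Φ) (_ : 𝒞.Countable) (_ : E ⊆ ⋃₀ 𝒞) (_ : ∀ I ∈ 𝒞, ν I ≤ ε),
      ∑' I : 𝒞, ν (I : Set ℝ) ^ (α : ℝ)

/-- The Hausdorff-Billingsley dimension of `E` with respect to `ν` and the family `Φ`:
the infimum of all `α > 0` with vanishing `ν`-`α`-Hausdorff-Billingsley measure. -/
def hbDimFamily (E : Set ℝ) (ν : Measure ℝ) (Φ : Set (Set ℝ)) : ℝ≥0∞ :=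
  ⨅ (α : ℝ≥0) (_ : 0 < α) (_ : hbMeasure α E ν Φ = 0), (α : ℝ≥0∞)

/-- The family of all bounded closed intervals of the real line. -/
def closedIntervals : Set (Set ℝ) :=
  {I | ∃ c d : ℝ, c ≤ d ∧ I = Set.Icc c d}

/-- The family of all closed subintervals of the smallest closed interval containing the
(bounded) set `M`. -/
def closedSubintervals (M : Set ℝ) : Set (Set ℝ) :=
  {I | ∃ c d : ℝ, sInf M ≤ c ∧ c ≤ d ∧ d ≤ sSup M ∧ I = Set.Icc c d}

/-- The classical Hausdorff-Billingsley dimension of `E` with respect to `ν`: coverings by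
closed intervals. By `hbDimFamily_closedSubintervals` below, for a bounded set `M` containing `E`
nothing changes if only closed subintervals of the smallest closed interval containing `M` are
admitted. -/
def hbDim (E : Set ℝ) (ν : Measure ℝ) : ℝ≥0∞ :=
  hbDimFamily E ν closedIntervals

theorem hbMeasure_closedSubintervals (α : ℝ≥0) {E M : Set ℝ} (hM : Bornology.IsBounded M)
    (hE : E ⊆ M) (ν : Measure ℝ) :
    hbMeasure α E ν (closedSubintervals M) = hbMeasure α E ν closedIntervals := by
  refine le_antisymm (iSup₂_mono fun ε _ => ?_) (iSup₂_mono fun ε _ => ?_)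
  · refine le_iInf fun 𝒞 => le_iInf fun h1 => le_iInf fun h2 => le_iInf fun h3 =>
      le_iInf fun h4 => ?_
    let f : Set ℝ → Set ℝ := fun I => I ∩ Set.Icc (sInf M) (sSup M)
    let 𝒟 : Set (Set ℝ) := f '' {I ∈ 𝒞 | (f I).Nonempty}
    have hD : ∀ J : 𝒟, ∃ I : 𝒞, f I = J := by
      rintro ⟨_, I, ⟨hI, -⟩, rfl⟩
      exact ⟨⟨I, hI⟩, rfl⟩
    choose g hg using hD
    have hginj : Function.Injective g := by
      intro J K hJK
      apply Subtype.ext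
      rw [← hg J, ← hg K, hJK]
    have hle : ∀ J : 𝒟, ν (J : Set ℝ) ≤ ν (g J : Set ℝ) := by
      intro J
      rw [← hg J]
      exact measure_mono Set.inter_subset_left
    refine iInf_le_of_le 𝒟 (iInf_le_of_le ?_ (iInf_le_of_le ?_ (iInf_le_of_le ?_
      (iInf_le_of_le ?_ ?_))))
    · rintro _ ⟨I, ⟨hI, hne⟩, rfl⟩
      obtain ⟨c, d, -, rfl⟩ := h1 hI
      have hf : f (Set.Icc c d) = Set.Icc (max c (sInf M)) (min d (sSup M)) := Set.Icc_inter_Icc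
      rw [hf] at hne ⊢
      exact ⟨_, _, le_max_right _ _, Set.nonempty_Icc.1 hne, min_le_right _ _, rfl⟩
    · exact (h2.mono (Set.sep_subset _ _)).image f
    · intro x hx
      obtain ⟨I, hI, hxI⟩ := h3 hx
      have hxf : x ∈ f I := ⟨hxI, csInf_le hM.bddBelow (hE hx), le_csSup hM.bddAbove (hE hx)⟩
      exact ⟨f I, ⟨I, ⟨hI, ⟨x, hxf⟩⟩, rfl⟩, hxf⟩
    · intro J hJ
      exact (hle ⟨J, hJ⟩).trans (h4 _ (g ⟨J, hJ⟩).2)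
    · calc ∑' J : 𝒟, ν (J : Set ℝ) ^ (α : ℝ)
          ≤ ∑' J : 𝒟, ν (g J : Set ℝ) ^ (α : ℝ) :=
            ENNReal.tsum_le_tsum fun J => ENNReal.rpow_le_rpow (hle J) α.2
        _ ≤ ∑' I : 𝒞, ν (I : Set ℝ) ^ (α : ℝ) :=
            ENNReal.tsum_comp_le_tsum_of_injective hginj
              (fun I : 𝒞 => ν (I : Set ℝ) ^ (α : ℝ))
  · refine iInf_mono fun 𝒞 => iInf_mono' fun h1 => ⟨?_, le_rfl⟩
    intro I hI
    obtain ⟨c, d, -, hcd, -, rfl⟩ := h1 hI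
    exact ⟨c, d, hcd, rfl⟩

theorem hbDimFamily_closedSubintervals {E M : Set ℝ} (hM : Bornology.IsBounded M)
    (hE : E ⊆ M) (ν : Measure ℝ) :
    hbDimFamily E ν (closedSubintervals M) = hbDim E ν := by
  simp only [hbDim, hbDimFamily, hbMeasure_closedSubintervals _ hM hE]

/-- The Hausdorff-Billingsley dimension of the measure `μ` with respect to the measure `ν`: the
infimum of the dimensions of all Borel sets of full `μ`-measure. -/
def hbDimMeasure (μ ν : Measure ℝ) : ℝ≥0∞ :=
  ⨅ (E : Set ℝ) (_ : MeasurableSet E) (_ : μ E = 1), hbDim E ν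

/-! ### Random incomplete sums of second Ostrogradsky series

All sequences are indexed from `0`, so that the `k`-th term (`k ≥ 1`) in the usual numbering has
index `k - 1` here; in particular the sign `(-1) ^ (k + 1)` becomes `(-1) ^ k`. -/

/-- A second Ostrogradsky sequence: positive integers with `q (k + 1) ≥ q k * (q k + 1)`. -/
def IsSecondOstrogradsky (q : ℕ → ℕ) : Prop :=
  ∀ k, 0 < q k ∧ q k * (q k + 1) ≤ q (k + 1)

/-- `ξ` is a sequence of independent random variables on `(Ω, P)`, the `k`-th of which takes
the values `i = 0` and `i = 1` with probabilities `p i k`, where `p 0 k + p 1 k = 1`. -/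
structure IsBernoulliSequence {Ω : Type*} [MeasurableSpace Ω] (P : Measure Ω)
    (ξ : ℕ → Ω → ℝ) (p : Fin 2 → ℕ → ℝ) : Prop where
  measurable : ∀ k, Measurable (ξ k)
  indep : iIndepFun ξ P
  prob_zero : ∀ k, P.real {ω | ξ k ω = 0} = p 0 k
  prob_one : ∀ k, P.real {ω | ξ k ω = 1} = p 1 k
  sum_eq_one : ∀ k, p 0 k + p 1 k = 1

/-- The distribution of the random variable `∑ k, (-1) ^ k * ξ k / q k`. -/
def seriesLaw {Ω : Type*} [MeasurableSpace Ω] (P : Measure Ω) (ξ : ℕ → Ω → ℝ) (q : ℕ → ℕ) :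
    Measure ℝ :=
  P.map fun ω => ∑' k, (-1 : ℝ) ^ k * ξ k ω / (q k : ℝ)

/-- The probabilities of the digits under the uniform distribution on the spectrum: `0` and `1`
are kept, and every value strictly between them is replaced by `1 / 2`. -/
def uniformProb (p : Fin 2 → ℕ → ℝ) (i : Fin 2) (k : ℕ) : ℝ :=
  if p i k = 0 then 0 else if p i k = 1 then 1 else 1 / 2

/-- The entropy of the `k`-th digit; `0 * log 0 = 0`. -/
def entropy (p : Fin 2 → ℕ → ℝ) (k : ℕ) : ℝ :=
  -(p 0 k * Real.log (p 0 k) + p 1 k * Real.log (p 1 k))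

/-- The sum of the entropies of the first `n` digits. -/
def entropySum (p : Fin 2 → ℕ → ℝ) (n : ℕ) : ℝ :=
  ∑ k ∈ Finset.range n, entropy p k

open Classical in
/-- The number of the first `n` digits whose entropy is positive. -/
def positiveCount (p : Fin 2 → ℕ → ℝ) (n : ℕ) : ℕ :=
  ((Finset.range n).filter fun k => 0 < entropy p k).card

end Ostrogradsky

end

/-! An incomplete sum of a series each of whose terms outweighs all later ones together determines
its digits, and the sums with a prescribed initial word of digits fill up an interval. If the word
contains exactly `m` digits of positive entropy, this interval has `ν*`-measure `2 ^ (-m)`, unless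
it is null for both measures, and a shorter interval (in the sense of `ν*`) meets at most two such
cylinders in positive measure. As in Billingsley's theorem, the dimension of `μ` is therefore
governed by the lower limit of `-log (μ (cylinder)) / (m * log 2)` at `μ`-almost every point.

For independent digits, `μ (cylinder)` is a product. Summing `x ^ (1 + t) ≤ x + t x log x + 8 t ^ 2`
over the values of each digit bounds the exponential moments of `log (μ (cylinder))`; digits of zero
entropy contribute nothing to the error, so the deviation of `-log (μ (cylinder))` from the entropy
sum exceeds `δ m` with probability exponentially small in `m`. By the Borel-Cantelli lemma the
deviation is almost surely `o(m)`, and the entropy sum does not change between consecutive digits of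
positive entropy, so that the lower limit over `m` is the lower limit over the length of the word.
-/

namespace Ostrogradsky

/-! ### Null and non-null sets for Hausdorff-Billingsley measures -/

section HBMeasure

variable {α : ℝ≥0} {E : Set ℝ} {ν : Measure ℝ} {Φ : Set (Set ℝ)}

lemma hbMeasure_eq_zero_of_tsum_ne_top {ι : Type*} [Countable ι] {I : ι → Set ℝ} (hα : 0 < α)
    (hI : ∀ i, I i ∈ Φ) (hE : ∀ x ∈ E, {i | x ∈ I i}.Infinite)
    (hsum : ∑' i, ν (I i) ^ (α : ℝ) ≠ ∞) : hbMeasure α E ν Φ = 0 := by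
  refine iSup₂_eq_bot.2 fun ε hε => bot_unique (le_of_forall_gt fun δ hδ => ?_)
  have hα' : (0 : ℝ) < α := hα
  obtain ⟨s, hs⟩ := ((ENNReal.tendsto_tsum_compl_atTop_zero hsum).eventually_lt_const
    (lt_min hδ (ENNReal.rpow_pos_of_nonneg hε hα'.le))).exists
  let J : {i // i ∉ s} → Set ℝ := fun i => I i
  have hJ (i : {i // i ∉ s}) : ν (J i) ≤ ε :=
    (ENNReal.rpow_le_rpow_iff hα').1 <|
      (ENNReal.le_tsum i).trans (hs.le.trans (min_le_right _ _))
  have hcover : E ⊆ ⋃₀ Set.range J := fun x hx => by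
    obtain ⟨i, hxi, his⟩ := (hE x hx).exists_notMem_finset s
    exact ⟨J ⟨i, his⟩, ⟨_, rfl⟩, hxi⟩
  refine lt_of_le_of_lt (b := ∑' K : Set.range J, ν (K : Set ℝ) ^ (α : ℝ)) ?_ ?_
  · exact iInf₂_le_of_le (Set.range J) (Set.range_subset_iff.2 fun i => hI i) <|
      iInf₂_le_of_le (Set.countable_range J) hcover <|
        iInf_le_of_le (Set.forall_mem_range.2 hJ) le_rfl
  · calc ∑' K : Set.range J, ν (K : Set ℝ) ^ (α : ℝ)
        ≤ ∑' i, ν (J i) ^ (α : ℝ) :=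
          ENNReal.tsum_le_tsum_comp_of_surjective Set.rangeFactorization_surjective _
      _ < δ := hs.trans_le (min_le_left _ _)

lemma hbMeasure_ne_zero_of_measure_inter_le {X : Type*} [MeasurableSpace X] {μ : Measure X}
    {s : X → ℝ} {A : Set X} {ε C : ℝ≥0∞} (hε : 0 < ε) (hC : C ≠ ∞) (hA : μ A ≠ 0)
    (hsA : Set.MapsTo s A E)
    (h : ∀ I ∈ Φ, ν I ≤ ε → μ (A ∩ s ⁻¹' I) ≤ C * ν I ^ (α : ℝ)) :
    hbMeasure α E ν Φ ≠ 0 := by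
  refine (lt_of_lt_of_le (ENNReal.div_pos hA hC) (le_iSup₂_of_le ε hε ?_)).ne'
  refine le_iInf₂ fun 𝒞 h𝒞 => le_iInf₂ fun hcount hcover => le_iInf fun hsmall => ?_
  have := hcount.to_subtype
  refine ENNReal.div_le_of_le_mul' ?_
  calc μ A ≤ μ (⋃ I : 𝒞, A ∩ s ⁻¹' I) := measure_mono fun x hx => by
        obtain ⟨I, hI, hxI⟩ := hcover (hsA hx)
        exact Set.mem_iUnion.2 ⟨⟨I, hI⟩, hx, hxI⟩
    _ ≤ ∑' I : 𝒞, μ (A ∩ s ⁻¹' I) := measure_iUnion_le _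
    _ ≤ ∑' I : 𝒞, C * ν (I : Set ℝ) ^ (α : ℝ) :=
        ENNReal.tsum_le_tsum fun I => h I (h𝒞 I.2) (hsmall I I.2)
    _ = C * ∑' I : 𝒞, ν (I : Set ℝ) ^ (α : ℝ) := ENNReal.tsum_mul_left

lemma hbDim_le_of_hbMeasure_eq_zero (hα : 0 < α) (h : hbMeasure α E ν closedIntervals = 0) :
    hbDim E ν ≤ α :=
  iInf₂_le_of_le α hα (iInf_le_of_le h le_rfl)

end HBMeasure

/-! ### Billingsley's theorem for dyadic codings -/

lemma exists_fiber_subset_preimage {X W : Type*} {π : X → W} {s : X → ℝ}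
    (hπ : ∀ w, ∃ J : Set ℝ, J.OrdConnected ∧ s ⁻¹' J = π ⁻¹' {w})
    {I : Set ℝ} (hI : I.OrdConnected) {T : Finset W} (hT : 2 < T.card)
    (hne : ∀ w ∈ T, (π ⁻¹' {w} ∩ s ⁻¹' I).Nonempty) :
    ∃ w ∈ T, π ⁻¹' {w} ⊆ s ⁻¹' I := by
  classical
  have : Nonempty X := by
    obtain ⟨w, hw⟩ := Finset.card_pos.1 (by omega : 0 < T.card)
    exact (hne w hw).to_type
  choose! x hxπ hxI using hne
  have hnT : T.Nonempty := Finset.card_pos.1 (by omega)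
  -- Any fibre other than those of the lowest and the highest sample point lies between the two.
  obtain ⟨u, huT, hu⟩ := T.exists_min_image (s ∘ x) hnT
  obtain ⟨v, hvT, hv⟩ := T.exists_max_image (s ∘ x) hnT
  obtain ⟨w, hwT, hw⟩ := Finset.exists_mem_notMem_of_card_lt_card
    ((Finset.card_le_two (a := u) (b := v)).trans_lt hT)
  obtain ⟨hwu, hwv⟩ : w ≠ u ∧ w ≠ v := by simpa using hw
  obtain ⟨J, hJ, hJw⟩ := hπ w
  have hJ_iff (y : X) : s y ∈ J ↔ π y = w := Set.ext_iff.1 hJw y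
  have hxw : s (x w) ∈ J := (hJ_iff _).2 (hxπ w hwT)
  refine ⟨w, hwT, fun y hy => hI.out (hxI u huT) (hxI v hvT) ⟨?_, ?_⟩⟩ <;> by_contra! hlt
  · exact hwu <| ((hJ_iff _).1 (hJ.out ((hJ_iff y).2 hy) hxw ⟨hlt.le, hu w hwT⟩)).symm.trans
      (hxπ u huT)
  · exact hwv <| ((hJ_iff _).1 (hJ.out hxw ((hJ_iff y).2 hy) ⟨hv w hwT, hlt.le⟩)).symm.trans
      (hxπ v hvT)

lemma measure_inter_preimage_le_two_mul {X W : Type*} [MeasurableSpace X] [Finite W]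
    {π : X → W} {s : X → ℝ} (hπ : ∀ w, ∃ J : Set ℝ, J.OrdConnected ∧ s ⁻¹' J = π ⁻¹' {w})
    {μ ν : Measure X} {b c : ℝ≥0∞} (hc : ∀ w, μ (π ⁻¹' {w}) ≠ 0 → c ≤ ν (π ⁻¹' {w}))
    {I : Set ℝ} (hI : I.OrdConnected) (hνI : ν (s ⁻¹' I) < c)
    {A : Set X} (hA : ∀ x ∈ A, μ (π ⁻¹' {π x}) ≤ b) :
    μ (A ∩ s ⁻¹' I) ≤ 2 * b := by
  classical
  have := Fintype.ofFinite W
  let T : Finset W := {w | μ (π ⁻¹' {w}) ≠ 0 ∧ (π ⁻¹' {w} ∩ (A ∩ s ⁻¹' I)).Nonempty}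
  have hT : T.card ≤ 2 := by
    by_contra! hcard
    obtain ⟨w, hwT, hw⟩ := exists_fiber_subset_preimage hπ hI hcard fun w hw =>
      (Finset.mem_filter.1 hw).2.2.mono (Set.inter_subset_inter_right _ Set.inter_subset_right)
    exact (((hc w (Finset.mem_filter.1 hwT).2.1).trans (measure_mono hw)).trans_lt hνI).false
  have hle (w : W) : μ (π ⁻¹' {w} ∩ (A ∩ s ⁻¹' I)) ≤ if w ∈ T then b else 0 := by
    split_ifs with hwT
    · obtain ⟨x, rfl, hxA, -⟩ := (Finset.mem_filter.1 hwT).2.2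
      exact (measure_mono Set.inter_subset_left).trans (hA x hxA)
    · rcases Set.eq_empty_or_nonempty (π ⁻¹' {w} ∩ (A ∩ s ⁻¹' I)) with h | h
      · simp [h]
      · have hw0 : μ (π ⁻¹' {w}) = 0 := by simpa [T, h] using hwT
        exact (measure_mono_null Set.inter_subset_left hw0).le
  calc μ (A ∩ s ⁻¹' I) ≤ μ (⋃ w, π ⁻¹' {w} ∩ (A ∩ s ⁻¹' I)) :=
        measure_mono fun x hx => Set.mem_iUnion.2 ⟨π x, rfl, hx⟩
    _ ≤ ∑ w, μ (π ⁻¹' {w} ∩ (A ∩ s ⁻¹' I)) := measure_iUnion_fintype_le _ _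
    _ ≤ ∑ w, if w ∈ T then b else 0 := Finset.sum_le_sum fun w _ => hle w
    _ = T.card * b := by simp
    _ ≤ 2 * b := by gcongr; exact_mod_cast hT

lemma exists_inv_two_pow_near {x : ℝ≥0∞} {N : ℕ} (hx0 : x ≠ 0) (hx : x < 2⁻¹ ^ N) :
    ∃ m ≥ N, x < 2⁻¹ ^ m ∧ 2⁻¹ ^ m ≤ 2 * x := by
  classical
  have hex : ∃ n : ℕ, (2⁻¹ : ℝ≥0∞) ^ n ≤ x :=
    (ENNReal.exists_inv_two_pow_lt hx0).imp fun _ h => h.le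
  have hN : N < Nat.find hex := (Nat.lt_find_iff hex N).2 fun j hj =>
    (hx.trans_le (pow_le_pow_right_of_le_one' (ENNReal.inv_le_one.2 one_le_two) hj)).not_ge
  obtain ⟨m, hm⟩ := Nat.exists_eq_succ_of_ne_zero (Nat.ne_zero_of_lt hN)
  refine ⟨m, by omega, not_le.1 (Nat.find_min hex (by omega)), ?_⟩
  calc (2⁻¹ : ℝ≥0∞) ^ m = 2 * 2⁻¹ ^ (m + 1) := by
        rw [pow_succ, mul_left_comm, ENNReal.mul_inv_cancel two_ne_zero ENNReal.ofNat_ne_top,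
          mul_one]
    _ ≤ 2 * x := by gcongr; simpa only [hm] using Nat.find_spec hex

lemma le_mul_rpow_of_dyadic {x y : ℝ≥0∞} {N : ℕ} {a : ℝ} (ha : 0 < a) (hx : x < 2⁻¹ ^ N)
    (h : ∀ m ≥ N, x < 2⁻¹ ^ m → y ≤ 2 * (2⁻¹ ^ m) ^ a) : y ≤ 2 * 2 ^ a * x ^ a := by
  rcases eq_or_ne x 0 with rfl | hx0
  · have hlim : Tendsto (fun m : ℕ => 2 * ((2⁻¹ : ℝ≥0∞) ^ m) ^ a) atTop (nhds (2 * 0 ^ a)) :=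
      ENNReal.Tendsto.const_mul ((ENNReal.continuous_rpow_const.tendsto 0).comp
        (ENNReal.tendsto_pow_atTop_nhds_zero_of_lt_one (by simp))) (Or.inr (by simp))
    rw [ENNReal.zero_rpow_of_pos ha, mul_zero] at hlim ⊢
    exact ge_of_tendsto hlim <| (eventually_ge_atTop N).mono fun m hm =>
      h m hm (ENNReal.pow_pos (by simp) m)
  · obtain ⟨m, hmN, hxm, hmx⟩ := exists_inv_two_pow_near hx0 hx
    calc y ≤ 2 * (2⁻¹ ^ m) ^ a := h m hmN hxm
      _ ≤ 2 * (2 * x) ^ a := by gcongr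
      _ = 2 * 2 ^ a * x ^ a := by rw [ENNReal.mul_rpow_of_nonneg _ _ ha.le, mul_assoc]

lemma card_mul_le_measure_univ {X W : Type*} [MeasurableSpace X] {μ : Measure X} {π : X → W}
    (hπ : ∀ w, MeasurableSet (π ⁻¹' {w})) {b : ℝ≥0∞} {G : Finset W}
    (hG : ∀ w ∈ G, b ≤ μ (π ⁻¹' {w})) : G.card * b ≤ μ Set.univ :=
  calc G.card * b ≤ ∑ w ∈ G, μ (π ⁻¹' {w}) := by
        simpa only [nsmul_eq_mul] using Finset.card_nsmul_le_sum G _ b hG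
    _ = μ (π ⁻¹' G) := sum_measure_preimage_singleton G fun w _ => hπ w
    _ ≤ μ Set.univ := measure_mono (Set.subset_univ _)

/-- A coding of a space `X`, embedded into the line by `s`, by words `π m x` such that the points
sharing a word of length `m` form an interval, of `ν`-measure exactly `2⁻¹ ^ m` unless it is
`μ`-null. It expresses that `ν` is equidistributed over the cylinders charged by `μ`. -/
structure IsDyadicCoding {X : Type*} [MeasurableSpace X] {W : ℕ → Type*} (π : ∀ m, X → W m)
    (s : X → ℝ) (μ ν : Measure X) : Prop where
  measurableEmbedding : MeasurableEmbedding s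
  exists_closedInterval : ∀ m w, ∃ I ∈ closedIntervals, s ⁻¹' I = π m ⁻¹' {w}
  measure_le : ∀ m w, ν (π m ⁻¹' {w}) ≤ 2⁻¹ ^ m
  le_measure : ∀ m w, μ (π m ⁻¹' {w}) ≠ 0 → 2⁻¹ ^ m ≤ ν (π m ⁻¹' {w})

namespace IsDyadicCoding

variable {X : Type*} [MeasurableSpace X] {W : ℕ → Type*} {π : ∀ m, X → W m} {s : X → ℝ}
  {μ ν : Measure X}

lemma exists_ordConnected (h : IsDyadicCoding π s μ ν) (m : ℕ) (w : W m) :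
    ∃ J : Set ℝ, J.OrdConnected ∧ s ⁻¹' J = π m ⁻¹' {w} := by
  obtain ⟨_, ⟨c, d, -, rfl⟩, hI⟩ := h.exists_closedInterval m w
  exact ⟨_, Set.ordConnected_Icc, hI⟩

lemma measurableSet_fiber (h : IsDyadicCoding π s μ ν) (m : ℕ) (w : W m) :
    MeasurableSet (π m ⁻¹' {w}) := by
  obtain ⟨J, hJ, hJw⟩ := h.exists_ordConnected m w
  exact hJw ▸ h.measurableEmbedding.measurable hJ.measurableSet

variable [∀ m, Finite (W m)]

lemma tsum_measure_fiber_rpow_ne_top (h : IsDyadicCoding π s μ ν) [IsFiniteMeasure μ]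
    {r α : ℝ≥0} (hrα : r < α) :
    ∑' i : Σ m, {w : W m // ((2⁻¹ : ℝ≥0∞) ^ m) ^ (r : ℝ) ≤ μ (π m ⁻¹' {w})},
      ν (π i.1 ⁻¹' {i.2.1}) ^ (α : ℝ) ≠ ∞ := by
  classical
  have := fun m => Fintype.ofFinite (W m)
  have hpow (m : ℕ) : ((2⁻¹ : ℝ≥0∞) ^ m) ^ (α : ℝ) =
      (2⁻¹ ^ m) ^ (r : ℝ) * (2⁻¹ ^ ((α : ℝ) - r)) ^ m := by
    rw [← ENNReal.rpow_natCast, ← ENNReal.rpow_natCast, ← ENNReal.rpow_mul, ← ENNReal.rpow_mul,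
      ← ENNReal.rpow_mul, ← ENNReal.rpow_add _ _ (by simp) (by simp)]
    congr 1
    ring
  have hratio : (2⁻¹ : ℝ≥0∞) ^ ((α : ℝ) - r) < 1 :=
    ENNReal.rpow_lt_one (by simp) (sub_pos.2 (NNReal.coe_lt_coe.2 hrα))
  refine ne_top_of_le_ne_top (b := μ Set.univ * (1 - 2⁻¹ ^ ((α : ℝ) - r))⁻¹)
    (ENNReal.mul_ne_top (measure_ne_top μ _)
      (ENNReal.inv_ne_top.2 (tsub_pos_of_lt hratio).ne')) ?_
  rw [ENNReal.tsum_sigma', ← ENNReal.tsum_geometric, ← ENNReal.tsum_mul_left]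
  refine ENNReal.tsum_le_tsum fun m => ?_
  let G : Finset (W m) := {w | ((2⁻¹ : ℝ≥0∞) ^ m) ^ (r : ℝ) ≤ μ (π m ⁻¹' {w})}
  have hG : (G.card : ℝ≥0∞) * (2⁻¹ ^ m) ^ (r : ℝ) ≤ μ Set.univ :=
    card_mul_le_measure_univ (h.measurableSet_fiber m) fun w hw => (Finset.mem_filter.1 hw).2
  calc _ ≤ ∑' _ : {w : W m // ((2⁻¹ : ℝ≥0∞) ^ m) ^ (r : ℝ) ≤ μ (π m ⁻¹' {w})},
          ((2⁻¹ : ℝ≥0∞) ^ m) ^ (α : ℝ) :=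
        ENNReal.tsum_le_tsum fun w => ENNReal.rpow_le_rpow (h.measure_le m w) α.2
    _ = G.card * (2⁻¹ ^ m) ^ (α : ℝ) := by
        rw [tsum_fintype, Finset.sum_const, nsmul_eq_mul, Finset.card_univ, Fintype.card_subtype]
    _ = G.card * (2⁻¹ ^ m) ^ (r : ℝ) * (2⁻¹ ^ ((α : ℝ) - r)) ^ m := by rw [hpow, mul_assoc]
    _ ≤ μ Set.univ * (2⁻¹ ^ ((α : ℝ) - r)) ^ m := by gcongr

lemma hbDimMeasure_map_le (h : IsDyadicCoding π s μ ν) [IsProbabilityMeasure μ] {L : ℝ≥0∞}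
    (hL : ∀ r : ℝ≥0, L < r →
      ∀ᵐ x ∂μ, ∃ᶠ m in atTop, ((2⁻¹ : ℝ≥0∞) ^ m) ^ (r : ℝ) ≤ μ (π m ⁻¹' {π m x})) :
    hbDimMeasure (μ.map s) (ν.map s) ≤ L := by
  refine le_of_forall_gt fun c hc => ?_
  obtain ⟨α, hLα, hαc⟩ := ENNReal.lt_iff_exists_nnreal_btwn.1 hc
  obtain ⟨r, hLr, hrα⟩ := ENNReal.lt_iff_exists_nnreal_btwn.1 hLα
  rw [ENNReal.coe_lt_coe] at hrα
  obtain ⟨A, hA, hAmeas, hAr⟩ := (hL r hLr).exists_measurable_mem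
  choose I hI hIπ using h.exists_closedInterval
  have hs := h.measurableEmbedding
  have hfull : μ.map s (s '' A) = 1 := by
    rw [hs.map_apply, hs.injective.preimage_image, prob_compl_eq_zero_iff hAmeas |>.1 hA]
  refine (iInf₂_le_of_le (s '' A) (hs.measurableSet_image.2 hAmeas) <| iInf_le_of_le hfull <|
    hbDim_le_of_hbMeasure_eq_zero hrα.pos ?_).trans_lt hαc
  refine hbMeasure_eq_zero_of_tsum_ne_top (I := fun i :
    Σ m, {w : W m // ((2⁻¹ : ℝ≥0∞) ^ m) ^ (r : ℝ) ≤ μ (π m ⁻¹' {w})} => I i.1 i.2) hrα.pos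
    (fun i => hI _ _) ?_ ?_
  · rintro _ ⟨x, hx, rfl⟩
    refine Set.Infinite.of_image Sigma.fst ?_
    refine (Nat.frequently_atTop_iff_infinite.1 (hAr x hx)).mono fun m hm => ?_
    exact ⟨⟨m, π m x, hm⟩, (Set.ext_iff.1 (hIπ m (π m x)) x).2 rfl, rfl⟩
  · simpa only [hs.map_apply, hIπ] using h.tsum_measure_fiber_rpow_ne_top hrα

lemma le_hbDimMeasure_map (h : IsDyadicCoding π s μ ν) [IsProbabilityMeasure μ] {L : ℝ≥0∞}
    (hL : ∀ α : ℝ≥0, 0 < α → α < L →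
      ∀ᵐ x ∂μ, ∀ᶠ m in atTop, μ (π m ⁻¹' {π m x}) ≤ ((2⁻¹ : ℝ≥0∞) ^ m) ^ (α : ℝ)) :
    L ≤ hbDimMeasure (μ.map s) (ν.map s) := by
  have hs := h.measurableEmbedding
  refine le_iInf₂ fun E _ => le_iInf fun hE => le_iInf₂ fun α hα => le_iInf fun hzero => ?_
  by_contra! hαL
  rw [hs.map_apply] at hE
  have hpos : 0 < μ (⋃ N, s ⁻¹' E ∩
      {x | ∀ m ≥ N, μ (π m ⁻¹' {π m x}) ≤ ((2⁻¹ : ℝ≥0∞) ^ m) ^ (α : ℝ)}) := by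
    rw [← Set.inter_iUnion, measure_inter_conull' ?_, hE]
    · exact one_pos
    · refine measure_mono_null (fun x hx => ?_) (hL α hα hαL)
      simpa [eventually_atTop] using hx.2
  obtain ⟨N, hN⟩ := exists_measure_pos_of_not_measure_iUnion_null hpos.ne'
  refine hbMeasure_ne_zero_of_measure_inter_le (ε := 2⁻¹ ^ (N + 1)) (C := 2 * 2 ^ (α : ℝ))
    (ENNReal.pow_pos (by simp) _) (ENNReal.mul_ne_top (by simp) (by simp)) hN.ne'
    (fun x hx => hx.1) ?_ hzero
  rintro _ ⟨c, d, -, rfl⟩ hνI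
  rw [hs.map_apply] at hνI ⊢
  have hlt : (2⁻¹ : ℝ≥0∞) ^ (N + 1) < 2⁻¹ ^ N := by
    rw [pow_succ, ← div_eq_mul_inv]
    exact ENNReal.half_lt_self (by simp) (by simp)
  exact le_mul_rpow_of_dyadic (NNReal.coe_pos.2 hα) (hνI.trans_lt hlt) fun m hm hlt =>
    measure_inter_preimage_le_two_mul (h.exists_ordConnected m) (h.le_measure m)
      Set.ordConnected_Icc hlt fun x hx => hx.2 m hm

end IsDyadicCoding

/-! ### Concentration of the logarithm of the probability of a random word -/

lemma exp_le_one_add_add_sq_mul_exp_abs (u : ℝ) : Real.exp u ≤ 1 + u + u ^ 2 * Real.exp |u| := by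
  have h := Complex.norm_exp_sub_sum_le_norm_mul_exp (u : ℂ) 2
  have hcast : Complex.exp (u : ℂ) - ∑ m ∈ Finset.range 2, (u : ℂ) ^ m / (m.factorial : ℂ) =
      ((Real.exp u - (1 + u) : ℝ) : ℂ) := by
    simp [Finset.sum_range_succ]
  rw [hcast, Complex.norm_real, Complex.norm_real, Real.norm_eq_abs, Real.norm_eq_abs, sq_abs] at h
  linarith [le_abs_self (Real.exp u - (1 + u))]

lemma sq_mul_exp_half_le {y : ℝ} (hy : y ≤ 0) : y ^ 2 * Real.exp (y / 2) ≤ 8 := by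
  have hexp := Real.quadratic_le_exp_of_nonneg (x := -(y / 2)) (by linarith)
  calc y ^ 2 * Real.exp (y / 2) ≤ 8 * Real.exp (-(y / 2)) * Real.exp (y / 2) := by
        gcongr
        nlinarith
    _ = 8 := by rw [mul_assoc, ← Real.exp_add, neg_add_cancel, Real.exp_zero, mul_one]

lemma rpow_one_add_le {x t : ℝ} (hx : 0 ≤ x) (hx1 : x ≤ 1) (ht : |t| ≤ 1 / 2) :
    x ^ (1 + t) ≤ x - t * Real.negMulLog x + 8 * t ^ 2 := by
  rcases hx.eq_or_lt with rfl | hx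
  · have ht1 : 1 + t ≠ 0 := by linarith [(abs_le.1 ht).1]
    simp only [Real.zero_rpow ht1, Real.negMulLog_zero, mul_zero, sub_zero, zero_add]
    positivity
  set y := Real.log x with hy
  have hxy : x = Real.exp y := (Real.exp_log hx).symm
  have hy0 : y ≤ 0 := Real.log_nonpos hx.le hx1
  have habs : |y * t| ≤ -y / 2 := by
    rw [abs_mul, abs_of_nonpos hy0]
    nlinarith
  calc x ^ (1 + t) = x * Real.exp (y * t) := by
        rw [Real.rpow_add hx, Real.rpow_one, Real.rpow_def_of_pos hx]
    _ ≤ x * (1 + y * t + (y * t) ^ 2 * Real.exp |y * t|) := by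
        gcongr
        exact exp_le_one_add_add_sq_mul_exp_abs _
    _ ≤ x * (1 + y * t + (y * t) ^ 2 * Real.exp (-y / 2)) := by gcongr
    _ = x + t * (x * y) + t ^ 2 * (y ^ 2 * (x * Real.exp (-y / 2))) := by ring
    _ = x + t * (x * y) + t ^ 2 * (y ^ 2 * Real.exp (y / 2)) := by
        nth_rewrite 3 [hxy]
        rw [← Real.exp_add]
        ring_nf
    _ ≤ x + t * (x * y) + t ^ 2 * 8 := by
        gcongr
        exact sq_mul_exp_half_le hy0
    _ = x - t * Real.negMulLog x + 8 * t ^ 2 := by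
        rw [Real.negMulLog, ← hy]
        ring

lemma sum_rpow_one_add_le {ι : Type*} [Fintype ι] {x : ι → ℝ} (hx : x ∈ stdSimplex ℝ ι) {t : ℝ}
    (ht : |t| ≤ 1 / 2) :
    ∑ i, x i ^ (1 + t) ≤ Real.exp (-t * ∑ i, Real.negMulLog (x i) +
      8 * Fintype.card ι * t ^ 2 * if 0 < ∑ i, Real.negMulLog (x i) then 1 else 0) := by
  have hx01 (i : ι) : x i ∈ Set.Icc (0 : ℝ) 1 := mem_Icc_of_mem_stdSimplex hx i
  have hnonneg (i : ι) : 0 ≤ Real.negMulLog (x i) := Real.negMulLog_nonneg (hx01 i).1 (hx01 i).2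
  split_ifs with hpos
  · calc ∑ i, x i ^ (1 + t) ≤ ∑ i, (x i - t * Real.negMulLog (x i) + 8 * t ^ 2) :=
          Finset.sum_le_sum fun i _ => rpow_one_add_le (hx01 i).1 (hx01 i).2 ht
      _ = -t * ∑ i, Real.negMulLog (x i) + 8 * Fintype.card ι * t ^ 2 * 1 + 1 := by
          rw [Finset.sum_add_distrib, Finset.sum_sub_distrib, hx.2, ← Finset.mul_sum,
            Finset.sum_const, Finset.card_univ, nsmul_eq_mul]
          ring
      _ ≤ _ := Real.add_one_le_exp _
  · have hzero : ∑ i, Real.negMulLog (x i) = 0 :=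
      le_antisymm (not_lt.1 hpos) (Finset.sum_nonneg fun i _ => hnonneg i)
    have hrpow (i : ι) : x i ^ (1 + t) = x i := by
      have hi := (Finset.sum_eq_zero_iff_of_nonneg fun i _ => hnonneg i).1 hzero i
        (Finset.mem_univ i)
      have ht1 : 1 + t ≠ 0 := by linarith [(abs_le.1 ht).1]
      have hne : x i ≠ -1 := by linarith [(hx01 i).1]
      rcases (by simpa [Real.negMulLog, hne] using hi : x i = 0 ∨ x i = 1) with h | h <;>
        simp [h, Real.zero_rpow ht1]
    simp [hrpow, hx.2, hzero]

lemma entropy_eq_sum_negMulLog (p : Fin 2 → ℕ → ℝ) (k : ℕ) :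
    entropy p k = ∑ i, Real.negMulLog (p i k) := by
  simp only [entropy, Fin.sum_univ_two, Real.negMulLog]
  ring

/-- The probability of the word `w`, for independent letters of which the `k`-th one takes the
value `i` with probability `p i k`. -/
def wordProb {ι : Type*} {n : ℕ} (p : ι → ℕ → ℝ) (w : Fin n → ι) : ℝ :=
  ∏ k, p (w k) k

section Concentration

variable {p : Fin 2 → ℕ → ℝ} (hp : ∀ k, (fun i => p i k) ∈ stdSimplex ℝ (Fin 2)) {n : ℕ}
include hp

lemma wordProb_nonneg (w : Fin n → Fin 2) : 0 ≤ wordProb p w :=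
  Finset.prod_nonneg fun k _ => (hp k).1 (w k)

lemma sum_wordProb_rpow_le {t : ℝ} (ht : |t| ≤ 1 / 2) :
    ∑ w : Fin n → Fin 2, wordProb p w ^ (1 + t) ≤
      Real.exp (-t * entropySum p n + 16 * t ^ 2 * positiveCount p n) := by
  classical
  calc ∑ w : Fin n → Fin 2, wordProb p w ^ (1 + t)
      = ∑ w : Fin n → Fin 2, ∏ k : Fin n, p (w k) k ^ (1 + t) :=
        Finset.sum_congr rfl fun w _ =>
          (Real.finsetProd_rpow _ _ (fun (k : Fin n) _ => (hp k).1 (w k)) _).symm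
    _ = ∏ k : Fin n, ∑ i, p i k ^ (1 + t) :=
        (Fintype.prod_sum fun (k : Fin n) (i : Fin 2) => p i k ^ (1 + t)).symm
    _ = ∏ k ∈ Finset.range n, ∑ i, p i k ^ (1 + t) :=
        Fin.prod_univ_eq_prod_range (fun k => ∑ i, p i k ^ (1 + t)) n
    _ ≤ ∏ k ∈ Finset.range n, Real.exp
          (-t * entropy p k + 16 * t ^ 2 * if 0 < entropy p k then 1 else 0) := by
        refine Finset.prod_le_prod
          (fun k _ => Finset.sum_nonneg fun i _ => Real.rpow_nonneg ((hp k).1 i) _) fun k _ => ?_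
        rw [entropy_eq_sum_negMulLog]
        refine (sum_rpow_one_add_le (hp k) ht).trans_eq ?_
        rw [Fintype.card_fin]
        norm_num
    _ = Real.exp (-t * entropySum p n + 16 * t ^ 2 * positiveCount p n) := by
        rw [← Real.exp_sum, Finset.sum_add_distrib, ← Finset.mul_sum, ← Finset.mul_sum,
          Finset.sum_boole, entropySum, positiveCount]

lemma sum_wordProb_filter_le {t : ℝ} (ht : |t| ≤ 1 / 2) (y : ℝ) :
    ∑ w : Fin n → Fin 2 with 0 ≤ t * (Real.log (wordProb p w) + y), wordProb p w ≤
      Real.exp (t * (y - entropySum p n) + 16 * t ^ 2 * positiveCount p n) := by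
  -- Chernoff's method: on the event, the weight `exp (t * y) * wordProb p w ^ t` is at least `1`.
  have htilt (w : Fin n → Fin 2) (hw : 0 ≤ t * (Real.log (wordProb p w) + y)) :
      wordProb p w ≤ Real.exp (t * y) * wordProb p w ^ (1 + t) := by
    rcases (wordProb_nonneg hp w).eq_or_lt with h | h
    · rw [← h]
      positivity
    · rw [Real.rpow_add h, Real.rpow_one, Real.rpow_def_of_pos h, mul_left_comm, ← Real.exp_add]
      exact le_mul_of_one_le_right h.le (Real.one_le_exp (by linarith))
  calc ∑ w : Fin n → Fin 2 with 0 ≤ t * (Real.log (wordProb p w) + y), wordProb p w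
      ≤ ∑ w : Fin n → Fin 2 with 0 ≤ t * (Real.log (wordProb p w) + y),
          Real.exp (t * y) * wordProb p w ^ (1 + t) :=
        Finset.sum_le_sum fun w hw => htilt w (Finset.mem_filter.1 hw).2
    _ ≤ ∑ w : Fin n → Fin 2, Real.exp (t * y) * wordProb p w ^ (1 + t) :=
        Finset.sum_le_sum_of_subset_of_nonneg (Finset.subset_univ _) fun w _ _ =>
          mul_nonneg (Real.exp_pos _).le (Real.rpow_nonneg (wordProb_nonneg hp w) _)
    _ ≤ Real.exp (t * y) * Real.exp (-t * entropySum p n + 16 * t ^ 2 * positiveCount p n) := by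
        rw [← Finset.mul_sum]
        gcongr
        exact sum_wordProb_rpow_le hp ht
    _ = Real.exp (t * (y - entropySum p n) + 16 * t ^ 2 * positiveCount p n) := by
        rw [← Real.exp_add]
        ring_nf

lemma sum_wordProb_abs_log_add_entropySum_le {δ : ℝ} (hδ : 0 < δ) (hδ16 : δ ≤ 16) :
    ∑ w : Fin n → Fin 2 with
        δ * positiveCount p n ≤ |Real.log (wordProb p w) + entropySum p n|, wordProb p w ≤
      2 * Real.exp (-(δ ^ 2 / 64 * positiveCount p n)) := by
  classical
  -- The value `t = ± δ / 32` minimises `-|t| * δ + 16 * t ^ 2`.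
  have ht : |δ / 32| ≤ 1 / 2 := by
    rw [abs_of_pos (by positivity)]
    linarith
  have hupper := sum_wordProb_filter_le hp (n := n) ht
    (entropySum p n - δ * positiveCount p n)
  have hlower := sum_wordProb_filter_le hp (n := n) (t := -(δ / 32)) (by rwa [abs_neg])
    (entropySum p n + δ * positiveCount p n)
  let U : Finset (Fin n → Fin 2) := {w | 0 ≤ δ / 32 *
    (Real.log (wordProb p w) + (entropySum p n - δ * positiveCount p n))}
  let V : Finset (Fin n → Fin 2) := {w | 0 ≤ -(δ / 32) *
    (Real.log (wordProb p w) + (entropySum p n + δ * positiveCount p n))}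
  have hsub : (Finset.univ.filter fun w : Fin n → Fin 2 =>
      δ * positiveCount p n ≤ |Real.log (wordProb p w) + entropySum p n|) ⊆ U ∪ V := fun w hw => by
    simp only [U, V, Finset.mem_filter_univ, Finset.mem_union, le_abs] at hw ⊢
    exact hw.imp (fun h => mul_nonneg (by positivity) (by linarith))
      fun h => mul_nonneg_of_nonpos_of_nonpos (by linarith) (by linarith)
  have hnonneg := wordProb_nonneg hp (n := n)
  calc _ ≤ ∑ w ∈ U ∪ V, wordProb p w :=
        Finset.sum_le_sum_of_subset_of_nonneg hsub fun w _ _ => hnonneg w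
    _ ≤ ∑ w ∈ U, wordProb p w + ∑ w ∈ V, wordProb p w := by
        rw [← Finset.sum_union_inter]
        exact le_add_of_nonneg_right (Finset.sum_nonneg fun w _ => hnonneg w)
    _ ≤ _ := add_le_add hupper hlower
    _ = 2 * Real.exp (-(δ ^ 2 / 64 * positiveCount p n)) := by
        ring_nf

end Concentration

/-! ### Digits with positive entropy -/

section Levels

variable {p : Fin 2 → ℕ → ℝ}

lemma entropy_pos_iff {k : ℕ} (hp : (fun i => p i k) ∈ stdSimplex ℝ (Fin 2)) :
    0 < entropy p k ↔ max (p 0 k) (p 1 k) < 1 := by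
  have hone : p 1 k = 1 - p 0 k :=
    eq_sub_of_add_eq' ((Fin.sum_univ_two fun i => p i k).symm.trans hp.2)
  have hp0 : p 0 k ∈ Set.Icc (0 : ℝ) 1 := mem_Icc_of_mem_stdSimplex hp 0
  have hbin : entropy p k = Real.binEntropy (p 0 k) := by
    rw [entropy_eq_sum_negMulLog, Fin.sum_univ_two, hone,
      Real.binEntropy_eq_negMulLog_add_negMulLog_one_sub]
  rw [hbin, (Real.binEntropy_nonneg hp0.1 hp0.2).lt_iff_ne', Ne, Real.binEntropy_eq_zero, not_or,
    max_lt_iff, hone, sub_lt_self_iff, hp0.1.lt_iff_ne', hp0.2.lt_iff_ne, and_comm]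

lemma positiveCount_eq_count [DecidablePred fun k => 0 < entropy p k] (n : ℕ) :
    positiveCount p n = Nat.count (fun k => 0 < entropy p k) n := by
  rw [Nat.count_eq_card_filter_range, positiveCount]
  congr

/-- The index of the `m`-th digit of positive entropy, counted from `0`. It is the greatest length
of an initial segment containing exactly `m` digits of positive entropy. -/
noncomputable def level (p : Fin 2 → ℕ → ℝ) (m : ℕ) : ℕ :=
  Nat.nth (fun k => 0 < entropy p k) m

lemma positiveCount_level (hinf : {k | 0 < entropy p k}.Infinite) (m : ℕ) :
    positiveCount p (level p m) = m := by
  classical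
  rw [positiveCount_eq_count, level, Nat.count_nth_of_infinite hinf]

lemma map_positiveCount_atTop (hinf : {k | 0 < entropy p k}.Infinite) :
    map (positiveCount p) atTop = atTop := by
  classical
  simp only [funext (positiveCount_eq_count (p := p))]
  exact map_atTop_eq_of_gc (level p) 0 (Nat.count_monotone _)
    (fun n m _ => Nat.count_le_iff_le_nth hinf) fun m _ => (Nat.count_nth_of_infinite hinf m).ge

lemma entropySum_level_positiveCount (hp : ∀ k, (fun i => p i k) ∈ stdSimplex ℝ (Fin 2))
    (hinf : {k | 0 < entropy p k}.Infinite) (n : ℕ) :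
    entropySum p (level p (positiveCount p n)) = entropySum p n := by
  classical
  have hle : n ≤ level p (positiveCount p n) := by
    rw [positiveCount_eq_count]
    exact Nat.le_nth_count hinf n
  refine (Finset.sum_subset (Finset.range_subset_range.2 hle) fun k hk hkn => ?_).symm
  rw [Finset.mem_range] at hk hkn
  have hnonneg : 0 ≤ entropy p k := by
    rw [entropy_eq_sum_negMulLog]
    exact Finset.sum_nonneg fun i _ => Real.negMulLog_nonneg ((hp k).1 i)
      (mem_Icc_of_mem_stdSimplex (hp k) i).2
  refine hnonneg.eq_or_lt.elim Eq.symm fun hpos => ?_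
  have hcount : positiveCount p (k + 1) ≤ positiveCount p n := by
    rw [positiveCount_eq_count]
    exact (Nat.count_le_iff_le_nth hinf).2 hk
  have hmono : positiveCount p n ≤ positiveCount p k := by
    simp only [positiveCount_eq_count]
    exact Nat.count_monotone _ (not_lt.1 hkn)
  rw [positiveCount_eq_count (k + 1), Nat.count_succ, if_pos hpos,
    ← positiveCount_eq_count] at hcount
  omega

lemma liminf_entropySum_div_positiveCount (hp : ∀ k, (fun i => p i k) ∈ stdSimplex ℝ (Fin 2))
    (hinf : {k | 0 < entropy p k}.Infinite) :
    liminf (fun n : ℕ => ENNReal.ofReal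
        (entropySum p n / ((positiveCount p n : ℝ) * Real.log 2))) atTop =
      liminf (fun m : ℕ => ENNReal.ofReal (entropySum p (level p m) / (m * Real.log 2))) atTop := by
  conv_rhs => rw [← map_positiveCount_atTop hinf, ← liminf_comp]
  simp only [Function.comp_def, entropySum_level_positiveCount hp hinf]

lemma entropy_pos_iff_ne_one {k : ℕ} (hp : (fun i => p i k) ∈ stdSimplex ℝ (Fin 2)) {i : Fin 2}
    (hi : p i k ≠ 0) : 0 < entropy p k ↔ p i k ≠ 1 := by
  have hsum : p 0 k + p 1 k = 1 := (Fin.sum_univ_two fun i => p i k).symm.trans hp.2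
  have hnonneg : 0 ≤ p i k := hp.1 i
  have hle : p i k ≤ 1 := (mem_Icc_of_mem_stdSimplex hp i).2
  rw [entropy_pos_iff hp, max_lt_iff]
  fin_cases i <;> dsimp only at * <;> grind

lemma uniformProb_eq {k : ℕ} (hp : (fun i => p i k) ∈ stdSimplex ℝ (Fin 2)) {i : Fin 2}
    (hi : p i k ≠ 0) : uniformProb p i k = (1 / 2) ^ if 0 < entropy p k then 1 else 0 := by
  have hiff := entropy_pos_iff_ne_one hp hi
  by_cases hone : p i k = 1 <;> simp [uniformProb, hiff, hi, hone]

lemma wordProb_uniformProb (hp : ∀ k, (fun i => p i k) ∈ stdSimplex ℝ (Fin 2)) {n : ℕ}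
    (w : Fin n → Fin 2) :
    wordProb (uniformProb p) w =
      if wordProb p w = 0 then 0 else (1 / 2) ^ positiveCount p n := by
  classical
  split_ifs with hw
  · obtain ⟨k, -, hk⟩ := Finset.prod_eq_zero_iff.1 hw
    exact Finset.prod_eq_zero (Finset.mem_univ k) (by rw [uniformProb, if_pos hk])
  · have hne : ∀ k, p (w k) k ≠ 0 := by simpa [wordProb, Finset.prod_eq_zero_iff] using hw
    calc wordProb (uniformProb p) w
        = ∏ k : Fin n, (1 / 2 : ℝ) ^ if 0 < entropy p k then 1 else 0 :=
          Finset.prod_congr rfl fun k _ => uniformProb_eq (hp k) (hne k)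
      _ = ∏ k ∈ Finset.range n, (1 / 2 : ℝ) ^ if 0 < entropy p k then 1 else 0 :=
          Fin.prod_univ_eq_prod_range (fun k => (1 / 2 : ℝ) ^ if 0 < entropy p k then 1 else 0) n
      _ = (1 / 2) ^ positiveCount p n := by
          rw [Finset.prod_pow_eq_pow_sum, ← Finset.card_filter, positiveCount]

end Levels

/-! ### Incomplete sums of super-decreasing series -/

/-- Each term of the series `∑ k, a k` outweighs all later terms together, so that the order of
two of its incomplete sums is decided by the first summand that only one of them contains. -/
structure IsSuperdecreasing (a : ℕ → ℝ) : Prop where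
  summable : Summable fun k => |a k|
  tsum_lt : ∀ n, ∑' k, |a (k + (n + 1))| < |a n|

/-- The incomplete sum of the series `∑ k, a k` with the digits `d`. -/
noncomputable def digitSum (a : ℕ → ℝ) (d : ℕ → Fin 2) : ℝ :=
  ∑' k, a k * (d k : ℕ)

/-- The word formed by the first `n` digits of `d`. -/
def digitPrefix {ι : Type*} (n : ℕ) (d : ℕ → ι) : Fin n → ι := fun k => d k

lemma digitPrefix_eq_iff {ι : Type*} {n : ℕ} {d e : ℕ → ι} :
    digitPrefix n d = digitPrefix n e ↔ ∀ k < n, d k = e k :=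
  ⟨fun h k hk => congrFun h ⟨k, hk⟩, fun h => funext fun k => h k k.2⟩

lemma continuous_digitPrefix {ι : Type*} [TopologicalSpace ι] (n : ℕ) :
    Continuous (digitPrefix n : (ℕ → ι) → Fin n → ι) :=
  continuous_pi fun k => continuous_apply (k : ℕ)

lemma abs_mul_digit_le (x : ℝ) (i : Fin 2) : |x * (i : ℕ)| ≤ |x| := by
  fin_cases i <;> simp

namespace IsSuperdecreasing

variable {a : ℕ → ℝ} (ha : IsSuperdecreasing a)
include ha

lemma summable_mul_digit (d : ℕ → Fin 2) : Summable fun k => a k * (d k : ℕ) :=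
  ha.summable.of_norm_bounded fun k => abs_mul_digit_le (a k) (d k)

lemma continuous_digitSum : Continuous (digitSum a) := by
  refine continuous_tsum (fun k => ?_) ha.summable fun k d => abs_mul_digit_le (a k) (d k)
  exact (continuous_of_discreteTopology (f := fun i : Fin 2 => a k * (i : ℕ))).comp
    (continuous_apply k)

lemma mul_digitSum_sub_pos {d e : ℕ → Fin 2} {n : ℕ} (hde : ∀ k < n, d k = e k) (hd : d n = 1)
    (he : e n = 0) : 0 < a n * (digitSum a d - digitSum a e) := by
  let f : ℕ → ℝ := fun k => a k * (d k : ℕ) - a k * (e k : ℕ)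
  have hf : Summable f := (ha.summable_mul_digit d).sub (ha.summable_mul_digit e)
  have hhead : ∑ k ∈ Finset.range (n + 1), f k = a n := by
    rw [Finset.sum_range_succ, Finset.sum_eq_zero fun k hk => ?_]
    · simp [f, hd, he]
    · simp [f, hde k (Finset.mem_range.1 hk)]
  have htail : |∑' k, f (k + (n + 1))| < |a n| := by
    have hle (k : ℕ) : ‖f (k + (n + 1))‖ ≤ |a (k + (n + 1))| := by
      simp only [f]
      generalize d (k + (n + 1)) = i, e (k + (n + 1)) = j
      fin_cases i <;> fin_cases j <;> simp
    exact (tsum_of_norm_bounded ((summable_nat_add_iff (n + 1)).2 ha.summable).hasSum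
      hle).trans_lt (ha.tsum_lt n)
  have hdiff : digitSum a d - digitSum a e = a n + ∑' k, f (k + (n + 1)) := by
    rw [← hhead, hf.sum_add_tsum_nat_add (n + 1)]
    exact ((ha.summable_mul_digit d).tsum_sub (ha.summable_mul_digit e)).symm
  have han : 0 < |a n| := (abs_nonneg _).trans_lt htail
  rw [hdiff, mul_add, ← abs_mul_abs_self (a n)]
  nlinarith [neg_abs_le (a n * ∑' k, f (k + (n + 1))), abs_mul (a n) (∑' k, f (k + (n + 1)))]

lemma eq_of_digitSum_mem_Icc {d e x : ℕ → Fin 2} {n : ℕ} (hde : ∀ k < n, d k = e k)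
    (hx : digitSum a x ∈ Set.Icc (digitSum a d) (digitSum a e)) : ∀ k < n, x k = d k := by
  intro k
  induction k using Nat.strong_induction_on with
  | _ k ih =>
    intro hk
    have hxd : ∀ j < k, x j = d j := fun j hj => ih j hj (hj.trans hk)
    have hxe : ∀ j < k, x j = e j := fun j hj => (hxd j hj).trans (hde j (hj.trans hk))
    have hek := (hde k hk).symm
    have hmul := mul_nonneg (sq_nonneg (a k))
      (mul_nonneg (sub_nonneg.2 hx.1) (sub_nonneg.2 hx.2))
    by_contra hne
    obtain ⟨hx1, hd0⟩ | ⟨hd1, hx0⟩ : (x k = 1 ∧ d k = 0) ∨ (d k = 1 ∧ x k = 0) := by omega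
    · have hd := ha.mul_digitSum_sub_pos hxd hx1 hd0
      have he := ha.mul_digitSum_sub_pos hxe hx1 (hek.trans hd0)
      linarith [mul_pos hd he]
    · have hd := ha.mul_digitSum_sub_pos (fun j hj => (hxd j hj).symm) hd1 hx0
      have he := ha.mul_digitSum_sub_pos (fun j hj => (hxe j hj).symm) (hek.trans hd1) hx0
      linarith [mul_pos hd he]

lemma injective_digitSum : Function.Injective (digitSum a) := fun _ _ h => funext fun k =>
  ha.eq_of_digitSum_mem_Icc (fun _ _ => rfl) (h ▸ Set.left_mem_Icc.2 le_rfl) k k.lt_succ_self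

lemma exists_preimage_digitSum_eq (n : ℕ) (w : Fin n → Fin 2) :
    ∃ I ∈ closedIntervals, digitSum a ⁻¹' I = digitPrefix n ⁻¹' {w} := by
  have hcompact : IsCompact (digitPrefix n ⁻¹' {w}) :=
    (isClosed_singleton.preimage (continuous_digitPrefix n)).isCompact
  have hne : (digitPrefix n ⁻¹' {w}).Nonempty :=
    ⟨fun k => if h : k < n then w ⟨k, h⟩ else 0, funext fun k => dif_pos k.2⟩
  obtain ⟨d, hd, hmin⟩ := hcompact.exists_isMinOn hne ha.continuous_digitSum.continuousOn
  obtain ⟨e, he, hmax⟩ := hcompact.exists_isMaxOn hne ha.continuous_digitSum.continuousOn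
  refine ⟨_, ⟨_, _, hmin he, rfl⟩, Set.Subset.antisymm (fun x hx => ?_) fun x hx =>
    ⟨hmin hx, hmax hx⟩⟩
  have hde := digitPrefix_eq_iff.1 (hd.trans he.symm)
  exact (digitPrefix_eq_iff.2 (ha.eq_of_digitSum_mem_Icc hde hx)).trans hd

end IsSuperdecreasing

lemma IsSecondOstrogradsky.two_mul_mul_three_pow_le {q : ℕ → ℕ} (hq : IsSecondOstrogradsky q)
    (n j : ℕ) : 2 * q n * 3 ^ j ≤ q (j + (n + 1)) := by
  induction j with
  | zero =>
    have := hq n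
    rw [zero_add]
    nlinarith
  | succ j ih =>
    have hlast := (hq (j + (n + 1))).2
    have hpos : 0 < q n * 3 ^ j := Nat.mul_pos (hq n).1 (by positivity)
    rw [pow_succ, show j + 1 + (n + 1) = j + (n + 1) + 1 by ring]
    nlinarith

lemma IsSecondOstrogradsky.isSuperdecreasing {q : ℕ → ℕ} (hq : IsSecondOstrogradsky q) :
    IsSuperdecreasing fun k => (-1 : ℝ) ^ k / q k := by
  have habs (k : ℕ) : |(-1 : ℝ) ^ k / q k| = 1 / q k := by
    rw [abs_div, abs_neg_one_pow, Nat.abs_cast]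
  have hle (n j : ℕ) : (1 : ℝ) / q (j + (n + 1)) ≤ 1 / (2 * q n) * (1 / 3) ^ j := by
    have hqn : (0 : ℝ) < q n := Nat.cast_pos.2 (hq n).1
    rw [one_div_pow, one_div_mul_one_div]
    exact one_div_le_one_div_of_le (by positivity)
      (by exact_mod_cast hq.two_mul_mul_three_pow_le n j)
  have hgeom (n : ℕ) := (hasSum_geometric_of_lt_one (r := (1 / 3 : ℝ))
    (by norm_num) (by norm_num)).mul_left (1 / (2 * (q n : ℝ)))
  have hsummable (n : ℕ) : Summable fun j => (1 : ℝ) / q (j + (n + 1)) :=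
    (hgeom n).summable.of_nonneg_of_le (fun j => by positivity) (hle n)
  refine ⟨?_, fun n => ?_⟩ <;> simp only [habs]
  · rw [← summable_nat_add_iff 1]
    simpa only [zero_add] using hsummable 0
  have hqn : (0 : ℝ) < q n := Nat.cast_pos.2 (hq n).1
  calc ∑' j, (1 : ℝ) / q (j + (n + 1)) ≤ 1 / (2 * q n) * (1 - 1 / 3)⁻¹ :=
        ((hsummable n).tsum_le_tsum (hle n) (hgeom n).summable).trans_eq (hgeom n).tsum_eq
    _ = 3 / 4 * (1 / q n) := by field_simp; norm_num
    _ < 1 / q n := by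
        have : 0 < 1 / (q n : ℝ) := by positivity
        linarith

/-! ### The law of the digits -/

/-- The digits `0` and `1` given by the values of `ξ`; any value other than `0` and `1`, taken with
probability `0` only, is read as `0`. -/
noncomputable def digits {Ω : Type*} (ξ : ℕ → Ω → ℝ) (ω : Ω) (k : ℕ) : Fin 2 :=
  if ξ k ω = 1 then 1 else 0

/-- Under `M`, the digits are independent, the `k`-th being `i` with probability `p i k`. -/
def HasWordProb (M : Measure (ℕ → Fin 2)) (p : Fin 2 → ℕ → ℝ) : Prop :=
  ∀ (n : ℕ) (w : Fin n → Fin 2), M (digitPrefix n ⁻¹' {w}) = ENNReal.ofReal (wordProb p w)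

namespace IsBernoulliSequence

variable {Ω : Type*} [MeasurableSpace Ω] {P : Measure Ω} {ξ : ℕ → Ω → ℝ} {p : Fin 2 → ℕ → ℝ}
  (hξ : IsBernoulliSequence P ξ p)
include hξ

lemma mem_stdSimplex (k : ℕ) : (fun i => p i k) ∈ stdSimplex ℝ (Fin 2) := by
  refine ⟨Fin.forall_fin_two.2 ⟨?_, ?_⟩, (Fin.sum_univ_two _).trans (hξ.sum_eq_one k)⟩
  · exact measureReal_nonneg.trans_eq (hξ.prob_zero k)
  · exact measureReal_nonneg.trans_eq (hξ.prob_one k)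

lemma measurable_digits : Measurable (digits ξ) :=
  measurable_pi_lambda _ fun k => Measurable.ite (hξ.measurable k (measurableSet_singleton 1))
    measurable_const measurable_const

variable [IsProbabilityMeasure P]

lemma measure_preimage_natCast (i : Fin 2) (k : ℕ) :
    P (ξ k ⁻¹' {((i : ℕ) : ℝ)}) = ENNReal.ofReal (p i k) := by
  rw [← ofReal_measureReal]
  fin_cases i
  · simp [← hξ.prob_zero k, Set.preimage]
  · simp [← hξ.prob_one k, Set.preimage]

lemma ae_eq_digits : ∀ᵐ ω ∂P, ∀ k, ξ k ω = (digits ξ ω k : ℕ) := by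
  refine ae_all_iff.2 fun k => ?_
  have hdisj : Disjoint (ξ k ⁻¹' {0}) (ξ k ⁻¹' {1}) :=
    Disjoint.preimage _ (Set.disjoint_singleton.2 zero_ne_one)
  have hmeas (x : ℝ) : MeasurableSet (ξ k ⁻¹' {x}) := hξ.measurable k (measurableSet_singleton x)
  have hone : P.real (ξ k ⁻¹' {0} ∪ ξ k ⁻¹' {1}) = 1 :=
    (measureReal_union hdisj (hmeas 1)).trans <|
      (congrArg₂ _ (hξ.prob_zero k) (hξ.prob_one k)).trans (hξ.sum_eq_one k)
  filter_upwards [(mem_ae_iff_prob_eq_one ((hmeas 0).union (hmeas 1))).2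
    (by rw [← ofReal_measureReal, hone, ENNReal.ofReal_one])] with ω hω
  obtain h | h : ξ k ω = 0 ∨ ξ k ω = 1 := hω <;> simp [digits, h]

lemma hasWordProb_map_digits : HasWordProb (P.map (digits ξ)) p := by
  intro n w
  have hae : digits ξ ⁻¹' (digitPrefix n ⁻¹' {w}) =ᵐ[P]
      (⋂ k ∈ (Finset.univ : Finset (Fin n)), ξ k ⁻¹' {((w k : ℕ) : ℝ)} : Set Ω) := by
    refine Filter.eventuallyEq_set.2 (hξ.ae_eq_digits.mono fun ω hω => ?_)
    simp [hω, Fin.val_inj, funext_iff, digitPrefix]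
  have hindep : iIndepFun (fun k : Fin n => ξ k) P := hξ.indep.precomp Fin.val_injective
  rw [Measure.map_apply hξ.measurable_digits
      ((continuous_digitPrefix n).measurable (measurableSet_singleton w)), measure_congr hae,
    hindep.measure_inter_preimage_eq_mul Finset.univ fun k _ => measurableSet_singleton _,
    wordProb, ENNReal.ofReal_prod_of_nonneg fun (k : Fin n) _ =>
      (hξ.mem_stdSimplex k).1 (w k)]
  exact Finset.prod_congr rfl fun k _ => hξ.measure_preimage_natCast (w k) k

lemma map_tsum_mul {a : ℕ → ℝ} (ha : Measurable (digitSum a)) :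
    P.map (fun ω => ∑' k, a k * ξ k ω) = (P.map (digits ξ)).map (digitSum a) := by
  rw [Measure.map_map ha hξ.measurable_digits]
  refine Measure.map_congr (hξ.ae_eq_digits.mono fun ω hω => ?_)
  simp only [Function.comp_apply, digitSum, hω]

end IsBernoulliSequence

/-! ### Asymptotic equipartition -/

section Equipartition

variable {p : Fin 2 → ℕ → ℝ} {M : Measure (ℕ → Fin 2)} (hM : HasWordProb M p)
  (hp : ∀ k, (fun i => p i k) ∈ stdSimplex ℝ (Fin 2))
include hM hp

lemma HasWordProb.measure_setOf_digitPrefix_mem {n : ℕ} (S : Finset (Fin n → Fin 2)) :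
    M {d | digitPrefix n d ∈ S} = ENNReal.ofReal (∑ w ∈ S, wordProb p w) := by
  rw [ENNReal.ofReal_sum_of_nonneg fun w _ => wordProb_nonneg hp w, ← Finset.sum_congr rfl
    fun w _ => hM n w, sum_measure_preimage_singleton S fun w _ =>
    (continuous_digitPrefix n).measurable (measurableSet_singleton w)]
  rfl

lemma HasWordProb.ae_wordProb_pos : ∀ᵐ d ∂M, ∀ n, 0 < wordProb p (digitPrefix n d) := by
  refine ae_all_iff.2 fun n => ?_
  have hnull := hM.measure_setOf_digitPrefix_mem hp {w : Fin n → Fin 2 | wordProb p w = 0}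
  rw [Finset.sum_eq_zero fun w hw => (Finset.mem_filter.1 hw).2, ENNReal.ofReal_zero] at hnull
  refine measure_mono_null (fun d hd => ?_) hnull
  have hle : wordProb p (digitPrefix n d) ≤ 0 := not_lt.1 hd
  simpa using hle.antisymm (wordProb_nonneg hp _)

lemma HasWordProb.ae_eventually_abs_log_add_entropySum_lt
    (hinf : {k | 0 < entropy p k}.Infinite) {δ : ℝ} (hδ : 0 < δ) :
    ∀ᵐ d ∂M, ∀ᶠ m : ℕ in atTop,
      |Real.log (wordProb p (digitPrefix (level p m) d)) + entropySum p (level p m)| < δ * m := by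
  wlog hδ16 : δ ≤ 16 generalizing δ
  · filter_upwards [this (by norm_num) le_rfl] with d hd
    exact hd.mono fun m hm => hm.trans_le (by gcongr; exact (not_le.1 hδ16).le)
  have htail (m : ℕ) : M {d | δ * m ≤
        |Real.log (wordProb p (digitPrefix (level p m) d)) + entropySum p (level p m)|} ≤
      ENNReal.ofReal (2 * Real.exp (m * -(δ ^ 2 / 64))) := by
    have hsum := sum_wordProb_abs_log_add_entropySum_le hp (n := level p m) hδ hδ16
    rw [positiveCount_level hinf] at hsum
    calc M _ = M {d | digitPrefix (level p m) d ∈ ({w : Fin (level p m) → Fin 2 | δ * m ≤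
            |Real.log (wordProb p w) + entropySum p (level p m)|} : Finset _)} := by simp
      _ ≤ ENNReal.ofReal (2 * Real.exp (m * -(δ ^ 2 / 64))) := by
        rw [hM.measure_setOf_digitPrefix_mem hp, mul_neg, mul_comm (m : ℝ)]
        exact ENNReal.ofReal_le_ofReal hsum
  have hsummable : Summable fun m : ℕ => 2 * Real.exp (m * -(δ ^ 2 / 64)) :=
    (Real.summable_exp_nat_mul_iff.2 (neg_neg_of_pos (by positivity))).mul_left 2
  filter_upwards [ae_eventually_notMem (ne_top_of_le_ne_top hsummable.tsum_ofReal_ne_top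
    (ENNReal.tsum_le_tsum htail))] with d hd
  exact hd.mono fun m hm => not_le.1 hm

lemma HasWordProb.ae_eventually_wordProb_mem_Ioo
    (hinf : {k | 0 < entropy p k}.Infinite) {δ : ℝ} (hδ : 0 < δ) :
    ∀ᵐ d ∂M, ∀ᶠ m : ℕ in atTop, wordProb p (digitPrefix (level p m) d) ∈
      Set.Ioo (Real.exp (-(entropySum p (level p m) + δ * m)))
        (Real.exp (-(entropySum p (level p m) - δ * m))) := by
  filter_upwards [hM.ae_wordProb_pos hp, hM.ae_eventually_abs_log_add_entropySum_lt hp hinf hδ]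
    with d hpos hlog
  refine hlog.mono fun m hm => ?_
  rw [Set.mem_Ioo, ← Real.lt_log_iff_exp_lt (hpos _), ← Real.log_lt_iff_lt_exp (hpos _)]
  constructor <;> linarith [abs_lt.1 hm]

end Equipartition

lemma inv_two_pow_eq_ofReal (m : ℕ) : (2⁻¹ : ℝ≥0∞) ^ m = ENNReal.ofReal ((1 / 2) ^ m) := by
  rw [ENNReal.ofReal_pow (by norm_num), one_div, ENNReal.ofReal_inv_of_pos two_pos,
    ENNReal.ofReal_ofNat]

lemma inv_two_pow_rpow_eq_ofReal_exp (m : ℕ) (r : ℝ≥0) :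
    ((2⁻¹ : ℝ≥0∞) ^ m) ^ (r : ℝ) = ENNReal.ofReal (Real.exp (-(r * (m * Real.log 2)))) := by
  rw [inv_two_pow_eq_ofReal, ENNReal.ofReal_rpow_of_nonneg (by positivity) r.coe_nonneg,
    Real.rpow_def_of_pos (by positivity), Real.log_pow, one_div, Real.log_inv]
  congr 2
  ring

/-! ### The dimension -/

section Dimension

variable {a : ℕ → ℝ} {p : Fin 2 → ℕ → ℝ} {M M' : Measure (ℕ → Fin 2)}

lemma IsSuperdecreasing.isDyadicCoding (ha : IsSuperdecreasing a) (hM : HasWordProb M p)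
    (hM' : HasWordProb M' (uniformProb p)) (hp : ∀ k, (fun i => p i k) ∈ stdSimplex ℝ (Fin 2))
    (hinf : {k | 0 < entropy p k}.Infinite) :
    IsDyadicCoding (fun m => digitPrefix (level p m)) (digitSum a) M M' := by
  have huniform (m : ℕ) (w : Fin (level p m) → Fin 2) : M' (digitPrefix (level p m) ⁻¹' {w}) =
      if wordProb p w = 0 then 0 else 2⁻¹ ^ m := by
    rw [hM', wordProb_uniformProb hp, positiveCount_level hinf, inv_two_pow_eq_ofReal]
    split_ifs <;> simp
  refine ⟨(ha.continuous_digitSum.isClosedEmbedding ha.injective_digitSum).measurableEmbedding,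
    fun m w => ha.exists_preimage_digitSum_eq _ w, fun m w => ?_, fun m w hw => ?_⟩
  · rw [huniform]
    split_ifs <;> simp
  · rw [huniform, if_neg fun h => hw (by rw [hM, h, ENNReal.ofReal_zero])]

lemma HasWordProb.ae_frequently_rpow_le (hM : HasWordProb M p)
    (hp : ∀ k, (fun i => p i k) ∈ stdSimplex ℝ (Fin 2)) (hinf : {k | 0 < entropy p k}.Infinite)
    {r : ℝ≥0} (hr : liminf (fun m : ℕ => ENNReal.ofReal
      (entropySum p (level p m) / (m * Real.log 2))) atTop < r) :
    ∀ᵐ d ∂M, ∃ᶠ m in atTop, ((2⁻¹ : ℝ≥0∞) ^ m) ^ (r : ℝ) ≤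
      M (digitPrefix (level p m) ⁻¹' {digitPrefix (level p m) d}) := by
  obtain ⟨b, hb, hbr⟩ := ENNReal.lt_iff_exists_nnreal_btwn.1 hr
  have hlog2 : 0 < Real.log 2 := Real.log_pos one_lt_two
  have hδ : 0 < (r - b : ℝ) * Real.log 2 :=
    mul_pos (sub_pos.2 (by exact_mod_cast hbr)) hlog2
  filter_upwards [hM.ae_eventually_wordProb_mem_Ioo hp hinf hδ] with d hd
  refine ((frequently_lt_of_liminf_lt (by isBoundedDefault) hb).and_eventually
    (hd.and (eventually_gt_atTop 0))).mono ?_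
  rintro m ⟨hmb, hm, hm0⟩
  have hm0 : 0 < (m : ℝ) * Real.log 2 := mul_pos (Nat.cast_pos.2 hm0) hlog2
  have hle : entropySum p (level p m) < b * (m * Real.log 2) :=
    (div_lt_iff₀ hm0).1 <| (Real.le_coe_toNNReal _).trans_lt <|
      NNReal.coe_lt_coe.2 (ENNReal.coe_lt_coe.1 hmb)
  rw [hM, inv_two_pow_rpow_eq_ofReal_exp]
  refine ENNReal.ofReal_le_ofReal (le_trans (Real.exp_le_exp.2 ?_) hm.1.le)
  linarith

lemma HasWordProb.ae_eventually_le_rpow (hM : HasWordProb M p)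
    (hp : ∀ k, (fun i => p i k) ∈ stdSimplex ℝ (Fin 2)) (hinf : {k | 0 < entropy p k}.Infinite)
    {α : ℝ≥0} (hα : α < liminf (fun m : ℕ => ENNReal.ofReal
      (entropySum p (level p m) / (m * Real.log 2))) atTop) :
    ∀ᵐ d ∂M, ∀ᶠ m in atTop, M (digitPrefix (level p m) ⁻¹' {digitPrefix (level p m) d}) ≤
      ((2⁻¹ : ℝ≥0∞) ^ m) ^ (α : ℝ) := by
  obtain ⟨b, hαb, hb⟩ := ENNReal.lt_iff_exists_nnreal_btwn.1 hα
  have hlog2 : 0 < Real.log 2 := Real.log_pos one_lt_two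
  have hδ : 0 < (b - α : ℝ) * Real.log 2 :=
    mul_pos (sub_pos.2 (by exact_mod_cast hαb)) hlog2
  filter_upwards [hM.ae_eventually_wordProb_mem_Ioo hp hinf hδ] with d hd
  filter_upwards [eventually_lt_of_lt_liminf hb, hd, eventually_gt_atTop 0] with m hmb hm hm0
  have hm0 : 0 < (m : ℝ) * Real.log 2 := mul_pos (Nat.cast_pos.2 hm0) hlog2
  have hle : b * (m * Real.log 2) < entropySum p (level p m) :=
    (lt_div_iff₀ hm0).1 (ENNReal.coe_lt_ofReal.1 hmb)
  rw [hM, inv_two_pow_rpow_eq_ofReal_exp]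
  refine ENNReal.ofReal_le_ofReal (hm.2.le.trans (Real.exp_le_exp.2 ?_))
  linarith

theorem IsSuperdecreasing.hbDimMeasure_map_digitSum [IsProbabilityMeasure M]
    (ha : IsSuperdecreasing a) (hM : HasWordProb M p) (hM' : HasWordProb M' (uniformProb p))
    (hp : ∀ k, (fun i => p i k) ∈ stdSimplex ℝ (Fin 2))
    (hinf : {k | 0 < entropy p k}.Infinite) :
    hbDimMeasure (M.map (digitSum a)) (M'.map (digitSum a)) =
      liminf (fun n : ℕ => ENNReal.ofReal
        (entropySum p n / ((positiveCount p n : ℝ) * Real.log 2))) atTop := by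
  have hcoding := ha.isDyadicCoding hM hM' hp hinf
  rw [liminf_entropySum_div_positiveCount hp hinf]
  exact le_antisymm (hcoding.hbDimMeasure_map_le fun r hr => hM.ae_frequently_rpow_le hp hinf hr)
    (hcoding.le_hbDimMeasure_map fun α _ hα => hM.ae_eventually_le_rpow hp hinf hα)

end Dimension

end Ostrogradsky

theorem mainTheorem3_general
    (a : ℕ → ℝ) (ha : Ostrogradsky.IsSuperdecreasing a)
    (p : Fin 2 → ℕ → ℝ)
    {Ω : Type*} [MeasurableSpace Ω] (P : Measure Ω) [IsProbabilityMeasure P]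
    (ξ : ℕ → Ω → ℝ) (hξ : Ostrogradsky.IsBernoulliSequence P ξ p)
    {Ω' : Type*} [MeasurableSpace Ω'] (P' : Measure Ω') [IsProbabilityMeasure P']
    (ξ' : ℕ → Ω' → ℝ)
    (hξ' : Ostrogradsky.IsBernoulliSequence P' ξ' (Ostrogradsky.uniformProb p))
    (hinf : {k : ℕ | max (p 0 k) (p 1 k) < 1}.Infinite) :
    Ostrogradsky.hbDimMeasure (P.map fun ω => ∑' k, a k * ξ k ω)
        (P'.map fun ω => ∑' k, a k * ξ' k ω) =
      liminf (fun n : ℕ => ENNReal.ofReal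
        (Ostrogradsky.entropySum p n / ((Ostrogradsky.positiveCount p n : ℝ) * Real.log 2)))
        atTop := by
  have hp := hξ.mem_stdSimplex
  have := Measure.isProbabilityMeasure_map (μ := P) hξ.measurable_digits.aemeasurable
  have hmeas : Measurable (Ostrogradsky.digitSum a) := ha.continuous_digitSum.measurable
  rw [hξ.map_tsum_mul hmeas, hξ'.map_tsum_mul hmeas]
  refine ha.hbDimMeasure_map_digitSum hξ.hasWordProb_map_digits hξ'.hasWordProb_map_digits hp ?_
  simpa only [Ostrogradsky.entropy_pos_iff (hp _)] using hinf

theorem mainTheorem3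
    (q : ℕ → ℕ) (hq : Ostrogradsky.IsSecondOstrogradsky q)
    (p : Fin 2 → ℕ → ℝ)
    {Ω : Type*} [MeasurableSpace Ω] (P : Measure Ω) [IsProbabilityMeasure P]
    (ξ : ℕ → Ω → ℝ) (hξ : Ostrogradsky.IsBernoulliSequence P ξ p)
    {Ω' : Type*} [MeasurableSpace Ω'] (P' : Measure Ω') [IsProbabilityMeasure P']
    (ξ' : ℕ → Ω' → ℝ)
    (hξ' : Ostrogradsky.IsBernoulliSequence P' ξ' (Ostrogradsky.uniformProb p))
    (hinf : {k : ℕ | max (p 0 k) (p 1 k) < 1}.Infinite) :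
    Ostrogradsky.hbDimMeasure (Ostrogradsky.seriesLaw P ξ q) (Ostrogradsky.seriesLaw P' ξ' q) =
      liminf (fun n : ℕ => ENNReal.ofReal
        (Ostrogradsky.entropySum p n / ((Ostrogradsky.positiveCount p n : ℝ) * Real.log 2)))
        atTop := by
  simpa only [Ostrogradsky.seriesLaw, ← div_mul_eq_mul_div] using
    mainTheorem3_general _ hq.isSuperdecreasing p P ξ hξ P' ξ' hξ' hinf
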